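/- Let $R$ be a finite commutative principal ideal ring with maximal ideals $\mathfrak m_1,\dots,\mathfrak m_k$, and let $t_i\ge 1$ be the index of stability of $\mathfrak m_i$, i.e. the smallest $e\ge 1$ with $\mathfrak m_i^{e}=\mathfrak m_i^{e+1}$. Put $R_i=R/\mathfrak m_i^{t_i}$, so that $R\cong\prod_{i=1}^k R_i$ is the canonical decomposition of $R$ into finite chain rings, and let $\mathbb F_{q_i}$ be the residue field of $R_i$. Assume that every $t_i$ is even. A (linear) code of length $n$ over $R$ is a submodule $C\subseteq R^n$; it is cyclic if $(c_{n-1},c_0,\dots,c_{n-2})\in C$ for all $(c_0,\dots,c_{n-1})\in C$, and self-dual if $C=C^{\perp}$, where $C^\perp=\{u\in R^n : \sum_j u_jv_j=0 \text{ for all } v\in C\}$. Let $C_i\subseteq R_i^n$ be the image of $C$ under coordinatewise reduction modulo $\mathfrak m_i^{t_i}$. The trivial code over $R_i$ is the code generated by $\gamma_i^{t_i/2}I_n$, where $\gamma_i$ generates the maximal ideal of $R_i$; the code $C$ over $R$ is called non-trivial if, for every $i$, its component $C_i$ is not the trivial code over $R_i$. Let $n=\ell^a$ with $\ell$ an odd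 prime and $a\ge 1$, and suppose $\gcd(n,q_i)=1$ for all $i$. Then there exists a non-trivial cyclic self-dual code of length $n$ over $R$ if and only if, for every $1\le i\le k$, the multiplicative order $\operatorname{ord}_n(q_i)$ of $q_i$ modulo $n$ is odd. -/

import Mathlib

namespace CyclicCodes

section LocalComponents

variable {R : Type*} [CommRing R]

/-- The index of stability of an ideal `I`: the smallest `e ≥ 1` with `I ^ e = I ^ (e + 1)`.
For a nilpotent ideal of a finite local ring this is its index of nilpotency. -/
noncomputable def stabilityIndex (I : Ideal R) : ℕ :=
  sInf {e : ℕ | 1 ≤ e ∧ I ^ e = I ^ (e + 1)}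

theorem stabilityIndex_spec [Finite R] (I : Ideal R) :
    1 ≤ stabilityIndex I ∧ I ^ stabilityIndex I = I ^ (stabilityIndex I + 1) := by
  have hne : {e : ℕ | 1 ≤ e ∧ I ^ e = I ^ (e + 1)}.Nonempty := by
    obtain ⟨n, hn⟩ := IsArtinian.monotone_stabilizes (R := R) (M := R)
      ⟨fun e => OrderDual.toDual (I ^ e), fun a b h => Ideal.pow_le_pow_right h⟩
    refine ⟨n + 1, by omega, ?_⟩
    have h1 := hn (n + 1) (by omega)
    have h2 := hn (n + 2) (by omega)
    exact (h1.symm.trans h2 :)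
  exact Nat.sInf_mem hne

/-- The local component `R / 𝔪 ^ t` of a finite ring `R` at a maximal ideal `𝔪`, where `t` is the
index of stability of `𝔪`. The canonical decomposition of `R` is the product of these rings over
all maximal ideals `𝔪` of `R`. -/
abbrev LocalComponent (m : MaximalSpectrum R) : Type _ :=
  R ⧸ (m.asIdeal ^ stabilityIndex m.asIdeal)

instance [Finite R] (m : MaximalSpectrum R) : IsLocalRing (LocalComponent m) := by
  set I : Ideal R := m.asIdeal ^ stabilityIndex m.asIdeal with hI
  have ht : stabilityIndex m.asIdeal ≠ 0 := by
    have := (stabilityIndex_spec m.asIdeal).1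
    omega
  have hle : I ≤ m.asIdeal := Ideal.pow_le_self ht
  have hm := m.isMaximal
  have hsurj : Function.Surjective (Ideal.Quotient.mk I) := Ideal.Quotient.mk_surjective
  have hcomap : Ideal.comap (Ideal.Quotient.mk I) (Ideal.map (Ideal.Quotient.mk I) m.asIdeal)
      = m.asIdeal := by
    rw [Ideal.comap_map_of_surjective' _ hsurj, Ideal.mk_ker]
    exact sup_eq_left.2 hle
  refine IsLocalRing.of_unique_max_ideal ⟨Ideal.map (Ideal.Quotient.mk I) m.asIdeal, ?_, ?_⟩
  · rcases Ideal.map_eq_top_or_isMaximal_of_surjective _ hsurj hm with h | h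
    · exact absurd (by rw [← hcomap, h, Ideal.comap_top]) hm.ne_top
    · exact h
  · intro M hM
    have hc : (Ideal.comap (Ideal.Quotient.mk I) M).IsMaximal :=
      Ideal.comap_isMaximal_of_surjective _ hsurj
    have h1 : I ≤ Ideal.comap (Ideal.Quotient.mk I) M := by
      rw [← Ideal.map_le_iff_le_comap, Ideal.map_quotient_self]
      exact bot_le
    have h2 : m.asIdeal = Ideal.comap (Ideal.Quotient.mk I) M :=
      hm.eq_of_le hc.ne_top (hc.isPrime.le_of_pow_le h1)
    exact (Ideal.map_comap_of_surjective _ hsurj M).symm.trans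
      (congrArg (Ideal.map (Ideal.Quotient.mk I)) h2.symm)

/-- The cardinality `q` of the residue field of the local component of `R` at `m`. -/
noncomputable def residueCard [Finite R] (m : MaximalSpectrum R) : ℕ :=
  Nat.card (IsLocalRing.ResidueField (LocalComponent m))

end LocalComponents

section Codes

variable {R : Type*} [CommRing R] {n : ℕ}

/-- A linear code `C` is cyclic if `(c_{n-1}, c_0, …, c_{n-2}) ∈ C` whenever
`(c_0, c_1, …, c_{n-1}) ∈ C`. -/
def IsCyclic (C : Submodule R (Fin n → R)) : Prop :=
  ∀ c ∈ C, (fun i => c ((finRotate n).symm i)) ∈ C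

/-- The dual code with respect to the standard inner product `[u, v] = ∑ u_i v_i`. -/
def dual (C : Submodule R (Fin n → R)) : Submodule R (Fin n → R) where
  carrier := {u | ∀ v ∈ C, ∑ i, u i * v i = 0}
  add_mem' := by
    intro a b ha hb v hv
    simp [add_mul, Finset.sum_add_distrib, ha v hv, hb v hv]
  zero_mem' := by
    intro v _
    simp
  smul_mem' := by
    intro r a ha v hv
    simp [mul_assoc, ← Finset.mul_sum, ha v hv]

/-- A code is self-dual if it equals its dual. -/
def IsSelfDual (C : Submodule R (Fin n → R)) : Prop :=
  C = dual C

/-- The coordinatewise reduction `R^n → (R / I)^n`. -/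
def reduction (I : Ideal R) (n : ℕ) : (Fin n → R) →ₛₗ[Ideal.Quotient.mk I] (Fin n → R ⧸ I) where
  toFun u := fun i => Ideal.Quotient.mk I (u i)
  map_add' _ _ := rfl
  map_smul' _ _ := rfl

/-- The `𝔪`-projection of a code over `R`: its image in `(R / 𝔪 ^ t)^n`. -/
noncomputable def component (C : Submodule R (Fin n → R)) (m : MaximalSpectrum R) :
    Submodule (LocalComponent m) (Fin n → LocalComponent m) :=
  C.map (reduction (m.asIdeal ^ stabilityIndex m.asIdeal) n)

/-- The trivial code of length `n` over a finite chain ring `S` whose maximal ideal `⟨γ⟩` has even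
nilpotency index `e`: the code with generator matrix `γ^{e/2} I_n`, that is, all vectors whose
coordinates lie in `⟨γ⟩ ^ (e/2)`. -/
noncomputable def trivialCode (S : Type*) [CommRing S] [IsLocalRing S] (n : ℕ) :
    Submodule S (Fin n → S) :=
  Submodule.pi Set.univ fun _ =>
    IsLocalRing.maximalIdeal S ^ (stabilityIndex (IsLocalRing.maximalIdeal S) / 2)

/-- A code over a finite principal ideal ring is non-trivial if none of its components over the
chain rings of the canonical decomposition is the trivial code. -/
def IsNontrivial [Finite R] (C : Submodule R (Fin n → R)) : Prop :=
  ∀ m : MaximalSpectrum R, component C m ≠ trivialCode (LocalComponent m) n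

end Codes

end CyclicCodes

/-! By the Chinese remainder theorem everything is decided at one chain ring `S` with maximal ideal
`⟨γ⟩`, nilpotency index `2e` and residue field `F` of order `q`. Cyclic codes are ideals of the
group algebra `S[ℤ/n]`, and orthogonality to all shifts of `v` means `u * σ v = 0`, where `σ` is
induced by `g ↦ -g`.

As `n` is an odd prime power, `-1` is a power of `q` modulo `n` exactly when the order of `q` is
even. If `q ^ s = -1`, then `σ` is the power map `x ↦ x ^ (q ^ s)` on `F[ℤ/n]`, so `x * σ x = 0`
forces `x = 0`; peeling off factors of `γ` puts a self-orthogonal cyclic code inside the trivial one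
(`pow_dvd_of_mem_of_selfOrthogonal`), and self-duality gives equality.

If `-1` is not a power of `q`, the orbit of `1` under multiplication by `q` misses `-1`. This yields
an idempotent `θ ≠ 0` with `θ * σ θ = 0`, which lifts to `S[ℤ/n]`. With `c = 1 - θ - σ θ`, the ideal
generated by `θ` and `γ ^ e • c` is self-dual and non-trivial
(`exists_selfDual_of_isIdempotentElem`). -/

namespace CyclicCodes

/-! ### Group algebras and the inversion involution -/

section GroupAlgebra

open AddMonoidAlgebra

variable {S : Type*} [CommRing S] {G : Type*}

/-- The element of the group algebra with a given family of coefficients. -/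
noncomputable def ofFun [Finite G] (u : G → S) : AddMonoidAlgebra S G :=
  ofCoeff (Finsupp.equivFunOnFinite.symm u)

@[simp]
theorem coeff_ofFun [Finite G] (u : G → S) (i : G) : (ofFun u).coeff i = u i := rfl

theorem ofFun_coeff [Finite G] (x : AddMonoidAlgebra S G) : ofFun (fun i => x.coeff i) = x := by
  ext i
  rfl

theorem ofFun_add [Finite G] (u v : G → S) : ofFun (u + v) = ofFun u + ofFun v := by
  ext i
  rfl

theorem ofFun_zero [Finite G] : ofFun (0 : G → S) = 0 := by
  ext i
  rfl

theorem ofFun_smul [Finite G] (c : S) (u : G → S) : ofFun (c • u) = c • ofFun u := by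
  ext i
  rfl

variable [AddCommGroup G]

/-- The involution of the group algebra `S[G]` induced by negation on `G`. -/
noncomputable abbrev involution (S G : Type*) [CommRing S] [AddCommGroup G] :
    AddMonoidAlgebra S G →+* AddMonoidAlgebra S G :=
  mapDomainRingHom S (negAddMonoidHom : G →+ G)

theorem coeff_involution (x : AddMonoidAlgebra S G) (k : G) :
    (involution S G x).coeff k = x.coeff (-k) := by
  have h : (involution S G x).coeff (negAddMonoidHom (-k)) = x.coeff (-k) :=
    Finsupp.mapDomain_apply (f := (negAddMonoidHom : G →+ G)) neg_injective x.coeff (-k)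
  simpa using h

theorem involution_involution (x : AddMonoidAlgebra S G) :
    involution S G (involution S G x) = x := by
  ext k
  rw [coeff_involution, coeff_involution, neg_neg]

theorem coeff_mul_eq_sum [Fintype G] (x y : AddMonoidAlgebra S G) (k : G) :
    (x * y).coeff k = ∑ i, x.coeff i * y.coeff (k - i) := by
  classical
  rw [coeff_mul_antidiag x y k (Finset.univ.image fun i => (i, k - i)), Finset.sum_image]
  · intro a _ b _ h
    exact (Prod.ext_iff.1 h).1
  · rintro ⟨a, b⟩
    simp only [Finset.mem_image, Finset.mem_univ, true_and, Prod.mk.injEq, exists_eq_left]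
    rw [sub_eq_iff_eq_add', eq_comm]

theorem coeff_mul_involution [Fintype G] (x y : AddMonoidAlgebra S G) (k : G) :
    (x * involution S G y).coeff k = ∑ i, x.coeff i * y.coeff (i - k) := by
  simp_rw [coeff_mul_eq_sum, coeff_involution, neg_sub]

theorem ofFun_shift [Finite G] (u : G → S) (k : G) :
    ofFun (fun i => u (i - k)) = ofFun u * single k 1 := by
  ext i
  rw [coeff_mul_single_eq_coeff_mul (i - k) fun m _ => eq_sub_iff_add_eq.symm]
  simp

end GroupAlgebra

/-! ### Idempotents and Frobenius over a finite field -/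

section FiniteField

open AddMonoidAlgebra

variable {F : Type*} [Field F] [Finite F] {G : Type*} [AddCommGroup G]

theorem exists_iterateFrobenius (F G : Type*) [Field F] [Finite F] [AddCommGroup G] :
    ∃ φ : AddMonoidAlgebra F G →+* AddMonoidAlgebra F G, ∀ x, φ x = x ^ Nat.card F := by
  have := Fintype.ofFinite F
  obtain ⟨p, hp⟩ := CharP.exists F
  obtain ⟨m, hpp, hm⟩ := FiniteField.card F p
  have : Fact p.Prime := ⟨hpp⟩
  have : CharP (AddMonoidAlgebra F G) p :=
    charP_of_injective_algebraMap (algebraMap F (AddMonoidAlgebra F G)).injective p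
  refine ⟨iterateFrobenius (AddMonoidAlgebra F G) p m, fun x => ?_⟩
  rw [iterateFrobenius_def, Nat.card_eq_fintype_card, hm]

/-- The `q`-power map is a ring homomorphism fixing the scalars, so it acts only on the exponents.
-/
theorem pow_card_eq_mapDomain (x : AddMonoidAlgebra F G) :
    x ^ Nat.card F = mapDomainRingHom F (nsmulAddMonoidHom (α := G) (Nat.card F)) x := by
  have := Fintype.ofFinite F
  obtain ⟨φ, hφ⟩ := exists_iterateFrobenius F G
  rw [← hφ]
  congr 1
  refine ringHom_ext (fun r => ?_) fun m => ?_
  · rw [hφ, single_pow, Nat.card_eq_fintype_card, FiniteField.pow_card]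
    simp
  · rw [hφ, single_pow]
    simp

theorem pow_card_pow_eq_mapDomain (x : AddMonoidAlgebra F G) (s : ℕ) :
    x ^ Nat.card F ^ s = mapDomainRingHom F (nsmulAddMonoidHom (α := G) (Nat.card F ^ s)) x := by
  induction s with
  | zero =>
    simp only [pow_zero, pow_one]
    have : nsmulAddMonoidHom (α := G) 1 = AddMonoidHom.id G := by
      ext; simp
    rw [this, mapDomainRingHom_id, RingHom.id_apply]
  | succ s ih =>
    rw [pow_succ, pow_mul, ih, pow_card_eq_mapDomain, ← RingHom.comp_apply,
      ← mapDomainRingHom_comp]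
    congr 2
    ext g
    simp [mul_smul, mul_comm]

/-- Here the involution is `x ↦ x ^ (q ^ s)`, so `x` is nilpotent; being an involution, it also
gives `x = x ^ (q ^ s * q ^ s)`. -/
theorem eq_zero_of_mul_involution_eq_zero {s : ℕ} (hs : s ≠ 0)
    (h : ∀ g : G, Nat.card F ^ s • g = -g) {x : AddMonoidAlgebra F G}
    (hx : x * involution F G x = 0) : x = 0 := by
  have hq : 2 ≤ Nat.card F ^ s :=
    (Finite.one_lt_card (α := F)).trans_le (Nat.le_self_pow hs _)
  have key : ∀ y : AddMonoidAlgebra F G, y ^ Nat.card F ^ s = involution F G y := fun y => by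
    rw [pow_card_pow_eq_mapDomain]
    congr 2
    ext g
    simpa using h g
  have h1 : x ^ (Nat.card F ^ s + 1) = 0 := by
    rw [pow_succ, key, mul_comm, hx]
  have h2 : (x ^ Nat.card F ^ s) ^ Nat.card F ^ s = x := by
    rw [key, key, involution_involution]
  rw [← h2, ← pow_mul]
  exact pow_eq_zero_of_le (by nlinarith) h1

/-- An element with `x ^ q = x` is an `F`-combination of the idempotents `1 - (x - c) ^ (q - 1)`; if
all of these were fixed by the involution, so would be `x`. -/
theorem exists_isIdempotentElem_ne_involution (x : AddMonoidAlgebra F G)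
    (hx : x ^ Nat.card F = x) (hne : involution F G x ≠ x) :
    ∃ θ : AddMonoidAlgebra F G, IsIdempotentElem θ ∧ involution F G θ ≠ θ := by
  classical
  have := Fintype.ofFinite F
  set q := Nat.card F with hq
  have hqF : q = Fintype.card F := Nat.card_eq_fintype_card
  have hq1 : 1 < q := Finite.one_lt_card
  -- Lagrange interpolation of the identity function on `F`.
  let p : Polynomial F := ∑ c : F, Polynomial.C c * (1 - (Polynomial.X - Polynomial.C c) ^ (q - 1))
  have hp : p = Polynomial.X := by
    refine Polynomial.eq_of_natDegree_lt_card_of_eval_eq p _ (f := id) Function.injective_id ?_ ?_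
    · intro c
      simp only [p, Polynomial.eval_finsetSum, id, Polynomial.eval_X]
      rw [Finset.sum_eq_single c]
      · simp [zero_pow (show q - 1 ≠ 0 by omega)]
      · intro b _ hb
        have : (c - b) ^ (q - 1) = 1 := by
          rw [hqF]; exact FiniteField.pow_card_sub_one_eq_one _ (sub_ne_zero.2 hb.symm)
        simp [this]
      · simp
    · rw [← hqF, max_lt_iff, Polynomial.natDegree_X]
      refine ⟨lt_of_le_of_lt ?_ (show q - 1 < q by omega), hq1⟩
      refine Polynomial.natDegree_sum_le_of_forall_le _ _ fun c _ => ?_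
      refine (Polynomial.natDegree_C_mul_le _ _).trans ((Polynomial.natDegree_sub_le _ _).trans ?_)
      simp
  let θ : F → AddMonoidAlgebra F G := fun c => 1 - (x - algebraMap F _ c) ^ (q - 1)
  have hsum : x = ∑ c, algebraMap F _ c * θ c := by
    have := congrArg (Polynomial.aeval x) hp
    simpa [p, θ] using this.symm
  obtain ⟨φ, hφ⟩ := exists_iterateFrobenius F G
  have hid : ∀ c, IsIdempotentElem (θ c) := fun c => by
    have hc : (x - algebraMap F _ c) ^ q = x - algebraMap F _ c := by
      rw [hq, ← hφ, map_sub, hφ, hφ, ← hq, hx, ← map_pow, hqF, FiniteField.pow_card]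
    refine IsIdempotentElem.one_sub ?_
    rw [IsIdempotentElem, ← pow_add, show q - 1 + (q - 1) = q + (q - 2) by omega, pow_add, hc,
      ← pow_succ', show q - 2 + 1 = q - 1 by omega]
  by_contra! hall
  apply hne
  have hC : ∀ c : F, involution F G (algebraMap F _ c) = algebraMap F _ c := fun c => by
    simp
  conv_lhs => rw [hsum]
  conv_rhs => rw [hsum]
  simp_rw [map_sum, map_mul, hC, hall _ (hid _)]

theorem exists_isIdempotentElem_mul_involution_eq_zero [Finite G]
    (hcop : (Nat.card G).Coprime (Nat.card F)) (g : G) (hg : ∀ s, Nat.card F ^ s • g ≠ -g) :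
    ∃ θ : AddMonoidAlgebra F G, IsIdempotentElem θ ∧ θ * involution F G θ = 0 ∧ θ ≠ 0 := by
  classical
  have := Fintype.ofFinite G
  set q := Nat.card F with hq
  let H : Finset G := Finset.univ.filter fun h => ∃ s, h = q ^ s • g
  have hinj : Function.Injective (fun h : G => q • h) := hcop.nsmul_right_bijective.1
  have hH : H.image (fun h => q • h) = H := by
    refine Finset.eq_of_subset_of_card_le ?_ (Finset.card_image_of_injective _ hinj).ge
    simp only [H, Finset.subset_iff, Finset.mem_image, Finset.mem_filter, Finset.mem_univ, true_and]
    rintro _ ⟨_, ⟨s, rfl⟩, rfl⟩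
    exact ⟨s + 1, by rw [pow_succ', mul_smul]⟩
  -- The orbit sum of `g` under multiplication by `q` is Frobenius-fixed, with coefficient `1` at
  -- `g` and `0` at `-g`.
  let w : AddMonoidAlgebra F G := ∑ h ∈ H, single h 1
  have hw : w ^ q = w := by
    rw [hq, pow_card_eq_mapDomain, map_sum]
    conv_rhs => rw [show w = ∑ h ∈ H, single h 1 from rfl, ← hH]
    rw [Finset.sum_image fun _ _ _ _ h => hinj h]
    simp [hq]
  have hcoeff : ∀ k, w.coeff k = if k ∈ H then 1 else 0 := fun k => by
    simp [w, coeff_sum, Finsupp.finsetSum_apply, Finsupp.single_apply]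
  obtain ⟨θ, h1, h2⟩ := exists_isIdempotentElem_ne_involution w hw fun h => by
    have := congrArg (fun x => x.coeff g) h
    simp only [coeff_involution, hcoeff] at this
    rw [if_neg, if_pos] at this
    · exact zero_ne_one this
    · simp only [H, Finset.mem_filter, Finset.mem_univ, true_and]
      exact ⟨0, by simp⟩
    · simp only [H, Finset.mem_filter, Finset.mem_univ, true_and]
      rintro ⟨s, hs⟩
      exact hg s hs.symm
  have h1' : IsIdempotentElem (involution F G θ) := h1.map (involution F G)
  refine ⟨θ * (1 - involution F G θ), h1.mul h1'.one_sub, ?_, fun h0 => h2 ?_⟩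
  · rw [map_mul, map_sub, map_one, involution_involution]
    linear_combination (1 - involution F G θ) * involution F G θ * -h1.eq
  · have h3 : θ = θ * involution F G θ := by linear_combination h0
    have h4 := congrArg (involution F G) h3
    rw [map_mul, involution_involution, mul_comm, ← h3] at h4
    exact h4

end FiniteField

end CyclicCodes

namespace CyclicCodes

/-! ### Group algebras over a chain ring -/

section ChainRing

open AddMonoidAlgebra IsLocalRing

variable {S : Type*} [CommRing S] [IsLocalRing S] {γ : S} {e : ℕ}

theorem dvd_of_pow_mul_eq_zero (hP : maximalIdeal S = Ideal.span {γ}) {j : ℕ} (hj : γ ^ j ≠ 0)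
    {w : S} (hw : γ ^ j * w = 0) : γ ∣ w := by
  rw [← Ideal.mem_span_singleton, ← hP, mem_maximalIdeal, mem_nonunits_iff]
  intro hu
  exact hj (hu.mul_left_eq_zero.1 hw)

theorem pow_dvd_of_pow_mul_eq_zero (hP : maximalIdeal S = Ideal.span {γ})
    (hne : ∀ j < 2 * e, γ ^ j ≠ 0) {w : S} (hw : γ ^ e * w = 0) : γ ^ e ∣ w := by
  have : ∀ i ≤ e, γ ^ i ∣ w := by
    intro i
    induction i with
    | zero => simp
    | succ i ih =>
      intro hi
      obtain ⟨v, rfl⟩ := ih (by omega)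
      rw [← mul_assoc, ← pow_add] at hw
      rw [pow_succ]
      exact mul_dvd_mul_left _ (dvd_of_pow_mul_eq_zero hP (hne _ (by omega)) hw)
  exact this e le_rfl

theorem residue_eq_zero_iff_dvd (hP : maximalIdeal S = Ideal.span {γ}) (w : S) :
    residue S w = 0 ↔ γ ∣ w := by
  rw [residue_eq_zero_iff, hP, Ideal.mem_span_singleton]

instance [Finite S] : Finite (ResidueField S) :=
  Finite.of_surjective _ residue_surjective

variable {G : Type*} [AddCommGroup G] [Fintype G]

/-- If `u = γ ^ j v` with `j < e`, cancelling `γ ^ (2 * j)` leaves `v` self-orthogonal modulo `γ`,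
so `v` vanishes in the residue group algebra and one more `γ` comes out. -/
theorem pow_dvd_of_mem_of_selfOrthogonal [Finite S] (hP : maximalIdeal S = Ideal.span {γ})
    (hne : ∀ j < 2 * e, γ ^ j ≠ 0) {s : ℕ} (hs : s ≠ 0)
    (hneg : ∀ g : G, Nat.card (ResidueField S) ^ s • g = -g) (u : G → S)
    (horth : ∀ k, ∑ i, u i * u (i - k) = 0) (i : G) : γ ^ e ∣ u i := by
  have : ∀ j ≤ e, ∀ i, γ ^ j ∣ u i := by
    intro j
    induction j with
    | zero => simp
    | succ j ih =>
      intro hj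
      choose v hv using ih (by omega)
      have h1 : ∀ k, γ ∣ ∑ i, v i * v (i - k) := fun k => by
        refine dvd_of_pow_mul_eq_zero hP (hne (j + j) (by omega)) ?_
        rw [← horth k, Finset.mul_sum]
        refine Finset.sum_congr rfl fun i _ => ?_
        rw [hv i, hv (i - k), pow_add]
        ring
      have h2 : ofFun (fun i => residue S (v i)) *
          involution (ResidueField S) G (ofFun fun i => residue S (v i)) = 0 := by
        ext k
        rw [coeff_mul_involution]
        simpa [map_sum] using (residue_eq_zero_iff_dvd hP _).2 (h1 k)
      have h3 := eq_zero_of_mul_involution_eq_zero hs hneg h2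
      intro i
      have h4 : residue S (v i) = 0 := congrArg (fun x => x.coeff i) h3
      rw [hv i, pow_succ]
      exact mul_dvd_mul_left _ ((residue_eq_zero_iff_dvd hP _).1 h4)
  exact this e le_rfl i

theorem exists_isIdempotentElem_lift [Finite S] (hP : maximalIdeal S = Ideal.span {γ})
    (hγ : γ ^ (2 * e) = 0) (hcop : (Nat.card G).Coprime (Nat.card (ResidueField S)))
    (g : G) (hg : ∀ s, Nat.card (ResidueField S) ^ s • g ≠ -g) :
    ∃ θ : AddMonoidAlgebra S G, IsIdempotentElem θ ∧ θ * involution S G θ = 0 ∧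
      ∃ i, ¬ γ ∣ θ.coeff i := by
  obtain ⟨θ₀, h1, h2, h3⟩ := exists_isIdempotentElem_mul_involution_eq_zero hcop g hg
  set f := mapRingHom G (residue S) with hf
  have hker : ∀ x ∈ RingHom.ker f, IsNilpotent x := fun x hx => by
    have hx' : ∀ i, γ ∣ x.coeff i := fun i => by
      rw [← residue_eq_zero_iff_dvd hP, ← coeff_mapRingHom, ← hf, RingHom.mem_ker.1 hx]
      rfl
    choose y hy using hx'
    have : x = γ • ofFun y := by
      ext i
      simpa using hy i
    exact ⟨2 * e, by rw [this, smul_pow, hγ, zero_smul]⟩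
  have hrange : θ₀ ∈ f.range := by
    choose y hy using fun i => residue_surjective (R := S) (θ₀.coeff i)
    refine ⟨ofFun y, ?_⟩
    ext i
    simp [hf, hy]
  obtain ⟨θ, hθ, rfl⟩ := exists_isIdempotentElem_eq_of_ker_isNilpotent f hker θ₀ hrange h1
  refine ⟨θ, hθ, ?_, ?_⟩
  -- This product is idempotent and, lying in the kernel, nilpotent; hence zero.
  · have h4 : IsIdempotentElem (θ * involution S G θ) := hθ.mul (hθ.map (involution S G))
    have h5 : θ * involution S G θ ∈ RingHom.ker f := by
      rw [RingHom.mem_ker, map_mul, ← h2]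
      congr 1
      exact RingHom.congr_fun (mapRingHom_comp_mapDomainRingHom _ _) _
    obtain ⟨n, hn⟩ := hker _ h5
    rcases n with _ | n
    · rw [← mul_one (θ * _), ← pow_zero, hn, mul_zero]
    · rwa [h4.pow_succ_eq] at hn
  · by_contra! hall
    refine h3 ?_
    ext i
    simpa [hf] using (residue_eq_zero_iff_dvd hP _).2 (hall i)

/-- The involution swaps `θ` and `σ θ` and fixes `c = 1 - θ - σ θ`. The code takes everything on
`θ`, nothing on `σ θ`, and the multiples of `γ ^ e` on `c`. -/
theorem exists_selfDual_of_isIdempotentElem (hP : maximalIdeal S = Ideal.span {γ})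
    (hγ : γ ^ (2 * e) = 0) (hne : ∀ j < 2 * e, γ ^ j ≠ 0) {θ : AddMonoidAlgebra S G}
    (hθ : IsIdempotentElem θ) (hθθ : θ * involution S G θ = 0) :
    ∃ D : Submodule S (G → S), (∀ u ∈ D, ∀ k, (fun i => u (i - k)) ∈ D) ∧
      (∀ u, u ∈ D ↔ ∀ v ∈ D, ∑ i, u i * v i = 0) ∧ (fun i => θ.coeff i) ∈ D := by
  set σ := involution S G with hσ
  have hee : γ ^ e * γ ^ e = 0 := by rw [← pow_add, ← two_mul, hγ]
  have hσs : ∀ (c : S) (x : AddMonoidAlgebra S G), σ (c • x) = c • σ x := fun c x => by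
    ext i
    simp [hσ]
  let D : Submodule S (G → S) :=
    { carrier := {u | ofFun u * σ θ = 0 ∧ γ ^ e • (ofFun u - ofFun u * θ) = 0}
      zero_mem' := by simp [ofFun_zero]
      add_mem' := by
        rintro u v ⟨h1, h2⟩ ⟨h3, h4⟩
        refine ⟨by rw [ofFun_add, add_mul, h1, h3, add_zero], ?_⟩
        rw [ofFun_add, add_mul, add_sub_add_comm, smul_add, h2, h4, add_zero]
      smul_mem' := by
        rintro c u ⟨h1, h2⟩
        refine ⟨by rw [ofFun_smul, smul_mul_assoc, h1, smul_zero], ?_⟩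
        rw [ofFun_smul, smul_mul_assoc, ← smul_sub, smul_comm, h2, smul_zero] }
  have hmem : ∀ u, u ∈ D ↔ ofFun u * σ θ = 0 ∧ γ ^ e • (ofFun u - ofFun u * θ) = 0 :=
    fun u => Iff.rfl
  have hshift : ∀ u ∈ D, ∀ k, (fun i => u (i - k)) ∈ D := fun u hu k => by
    rw [hmem] at hu ⊢
    rw [ofFun_shift]
    refine ⟨by rw [mul_right_comm, hu.1, zero_mul], ?_⟩
    rw [mul_right_comm, ← sub_mul, ← smul_mul_assoc, hu.2, zero_mul]
  have horth : ∀ u, (∀ v ∈ D, ∑ i, u i * v i = 0) → ∀ v ∈ D, ofFun u * σ (ofFun v) = 0 := by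
    intro u hu v hv
    ext k
    rw [coeff_mul_involution]
    exact hu _ (hshift v hv k)
  have hθD : (fun i => θ.coeff i) ∈ D := by
    rw [hmem, ofFun_coeff]
    exact ⟨hθθ, by rw [hθ.eq, sub_self, smul_zero]⟩
  -- Orthogonality to `θ` and to this element, with all their shifts, recovers the two equations
  -- defining `D`.
  have hcD : (fun i => (γ ^ e • (1 - θ - σ θ)).coeff i) ∈ D := by
    rw [hmem, ofFun_coeff]
    constructor
    · rw [smul_mul_assoc, sub_mul, sub_mul, hθθ, (hθ.map σ).eq, one_mul, sub_zero, sub_self,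
        smul_zero]
    · rw [smul_mul_assoc, ← smul_sub, smul_smul, hee, zero_smul]
  refine ⟨D, hshift, fun u => ⟨fun hu v hv => ?_, fun hu => ?_⟩, hθD⟩
  · rw [hmem] at hu hv
    have h1 : ∃ w, ofFun u - ofFun u * θ = γ ^ e • w := by
      have : ∀ i, γ ^ e ∣ (ofFun u - ofFun u * θ).coeff i := fun i =>
        pow_dvd_of_pow_mul_eq_zero hP hne (congrArg (fun x => x.coeff i) hu.2)
      choose w hw using this
      exact ⟨ofFun w, by ext i; simpa using hw i⟩
    obtain ⟨w, hw⟩ := h1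
    have h2 : θ * σ (ofFun v) = 0 := by
      have := congrArg σ hv.1
      rwa [map_mul, hσ, involution_involution, map_zero, mul_comm] at this
    have h3 : γ ^ e • σ (ofFun v) = γ ^ e • (σ (ofFun v) * σ θ) := by
      have := congrArg σ hv.2
      rwa [hσs, map_sub, map_mul, map_zero, smul_sub, sub_eq_zero] at this
    have h4 : ofFun u * σ (ofFun v) = 0 := by
      calc ofFun u * σ (ofFun v) = (ofFun u - ofFun u * θ) * σ (ofFun v) := by
            linear_combination ofFun u * h2
        _ = w * (γ ^ e • σ (ofFun v)) := by rw [hw, smul_mul_assoc, mul_smul_comm]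
        _ = (ofFun u - ofFun u * θ) * (σ (ofFun v) * σ θ) := by
            rw [h3, hw, smul_mul_assoc, mul_smul_comm]
        _ = 0 := by
            linear_combination σ (ofFun v) * hu.1 - ofFun u * σ (ofFun v) * hθθ
    have h5 := congrArg (fun x => x.coeff 0) h4
    beta_reduce at h5
    rw [coeff_mul_involution] at h5
    simpa using h5
  · rw [hmem]
    have h1 := horth u hu _ hθD
    have h2 := horth u hu _ hcD
    rw [ofFun_coeff] at h1 h2
    refine ⟨h1, ?_⟩
    rw [hσs, map_sub, map_sub, map_one, hσ, involution_involution, ← hσ, mul_smul_comm] at h2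
    rw [← h2]
    congr 1
    linear_combination h1

end ChainRing

end CyclicCodes

namespace CyclicCodes

/-! ### Powers of `q` equal to `-1` modulo an odd prime power -/

section NumberTheory

/-- An odd prime cannot divide both `y - 1` and `y + 1`, so the full prime power divides one of
them. -/
theorem eq_one_or_eq_neg_one_of_sq_eq_one {n : ℕ} (hn : IsPrimePow n) (hodd : Odd n) {x : ZMod n}
    (hx : x ^ 2 = 1) : x = 1 ∨ x = -1 := by
  obtain ⟨p, k, hp, hk, rfl⟩ := hn
  have hp' : Prime (p : ℤ) := Nat.prime_iff_prime_int.1 hp.nat_prime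
  have hp2 : p ≠ 2 := by
    rintro rfl
    exact Nat.not_even_iff_odd.2 hodd (even_two.pow_of_ne_zero hk.ne')
  obtain ⟨y, rfl⟩ := ZMod.intCast_surjective x
  have h : ((p ^ k : ℕ) : ℤ) ∣ (y - 1) * (y + 1) := by
    rw [← ZMod.intCast_zmod_eq_zero_iff_dvd]
    push_cast at hx ⊢
    linear_combination hx
  push_cast at h
  by_cases h1 : (p : ℤ) ∣ y - 1
  · have h2 : ¬ (p : ℤ) ∣ y + 1 := fun h2 => by
      have h3 : (p : ℤ) ∣ (2 : ℕ) := by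
        have := dvd_sub h2 h1
        ring_nf at this
        simpa using this
      exact hp2 ((Nat.prime_dvd_prime_iff_eq hp.nat_prime Nat.prime_two).1
        (Int.natCast_dvd_natCast.1 h3))
    left
    have h3 := ((hp'.coprime_iff_not_dvd.2 h2).pow_left (m := k)).dvd_of_dvd_mul_right h
    rw [← sub_eq_zero, ← Int.cast_one, ← Int.cast_sub, ZMod.intCast_zmod_eq_zero_iff_dvd]
    exact_mod_cast h3
  · right
    have h3 := ((hp'.coprime_iff_not_dvd.2 h1).pow_left (m := k)).dvd_of_dvd_mul_left h
    rw [eq_neg_iff_add_eq_zero, ← Int.cast_one, ← Int.cast_add, ZMod.intCast_zmod_eq_zero_iff_dvd]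
    exact_mod_cast h3

theorem exists_pow_eq_neg_one_of_even_orderOf {n q : ℕ} (hn : IsPrimePow n) (hodd : Odd n)
    (hcop : n.Coprime q) (heven : Even (orderOf (q : ZMod n))) :
    ∃ s ≠ 0, (q : ZMod n) ^ s = -1 := by
  have : NeZero n := ⟨hn.ne_zero⟩
  have hpos : 0 < orderOf (q : ZMod n) := by
    have := orderOf_pos (ZMod.unitOfCoprime q hcop.symm)
    rwa [← orderOf_units, ZMod.coe_unitOfCoprime] at this
  obtain ⟨s, hs⟩ := heven
  refine ⟨s, by omega, ?_⟩
  refine (eq_one_or_eq_neg_one_of_sq_eq_one hn hodd ?_).resolve_left fun h => ?_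
  · rw [← pow_mul, mul_two, ← hs, pow_orderOf_eq_one]
  · have := Nat.le_of_dvd (by omega) (orderOf_dvd_of_pow_eq_one h)
    omega

theorem pow_ne_neg_one_of_odd_orderOf {n : ℕ} (hn : 2 < n) {x : ZMod n} (hx : Odd (orderOf x))
    (s : ℕ) : x ^ s ≠ -1 := fun h => by
  have : Fact (2 < n) := ⟨hn⟩
  have h1 : (x ^ s) ^ orderOf x = 1 := by
    rw [← pow_mul, mul_comm, pow_mul, pow_orderOf_eq_one, one_pow]
  rw [h, hx.neg_one_pow] at h1
  exact ZMod.neg_one_ne_one h1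

theorem val_nsmul_one {n : ℕ} [NeZero n] (k : ℕ) : (k • (1 : Fin n)).val = k % n := by
  induction k with
  | zero => simp
  | succ k ih => rw [succ_nsmul, Fin.val_add, ih, Fin.val_one', Nat.add_mod]; simp

theorem pow_eq_neg_one_iff_dvd {n q s : ℕ} : (q : ZMod n) ^ s = -1 ↔ n ∣ q ^ s + 1 := by
  rw [← ZMod.natCast_eq_zero_iff]
  push_cast
  rw [eq_neg_iff_add_eq_zero]

theorem pow_nsmul_eq_neg {n q s : ℕ} [NeZero n] (h : (q : ZMod n) ^ s = -1) (g : Fin n) :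
    q ^ s • g = -g := by
  obtain ⟨c, hc⟩ := pow_eq_neg_one_iff_dvd.1 h
  rw [eq_neg_iff_add_eq_zero, ← succ_nsmul, hc, mul_nsmul]
  have : n • g = 0 := by simpa using card_nsmul_eq_zero (x := g)
  rw [this, smul_zero]

theorem pow_nsmul_one_ne_neg_one {n q s : ℕ} [NeZero n] (h : (q : ZMod n) ^ s ≠ -1) :
    q ^ s • (1 : Fin n) ≠ -1 := fun h1 => by
  rw [eq_neg_iff_add_eq_zero, ← succ_nsmul] at h1
  have := congrArg Fin.val h1
  rw [val_nsmul_one, Fin.val_zero] at this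
  exact h (pow_eq_neg_one_iff_dvd.2 (Nat.dvd_of_mod_eq_zero this))

end NumberTheory

/-! ### The canonical decomposition into local rings -/

section Decomposition

open IsLocalRing

theorem pow_eq_pow_of_pow_eq_pow_succ {M : Type*} [Monoid M] {a : M} {t : ℕ}
    (h : a ^ t = a ^ (t + 1)) {k : ℕ} (hk : t ≤ k) : a ^ k = a ^ t := by
  induction k, hk using Nat.le_induction with
  | base => rfl
  | succ k _ ih => rw [pow_succ, ih, ← pow_succ, ← h]

variable {R : Type*} [CommRing R] [Finite R]

theorem pow_eq_pow_stabilityIndex (I : Ideal R) {k : ℕ} (hk : stabilityIndex I ≤ k) :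
    I ^ k = I ^ stabilityIndex I :=
  pow_eq_pow_of_pow_eq_pow_succ (stabilityIndex_spec I).2 hk

theorem eq_zero_of_forall_mk_eq_zero {r : R}
    (h : ∀ m : MaximalSpectrum R,
      Ideal.Quotient.mk (m.asIdeal ^ stabilityIndex m.asIdeal) r = 0) : r = 0 := by
  obtain ⟨N, hN⟩ := IsArtinianRing.isNilpotent_nilradical (R := R)
  have h1 : r ∈ nilradical R ^ N := by
    rw [IsArtinianRing.nilradical_pow_eq_iInf, Ideal.mem_iInf]
    intro m
    have h2 := Ideal.Quotient.eq_zero_iff_mem.1 (h m)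
    rcases le_total (stabilityIndex m.asIdeal) N with hm | hm
    · rwa [pow_eq_pow_stabilityIndex _ hm]
    · exact Ideal.pow_le_pow_right hm h2
  rwa [hN] at h1

theorem exists_forall_mk_eq (x : ∀ m : MaximalSpectrum R, LocalComponent m) :
    ∃ r : R, ∀ m, Ideal.Quotient.mk (m.asIdeal ^ stabilityIndex m.asIdeal) r = x m :=
  Ideal.pi_quotient_surjective
    (fun _ _ h => (MaximalSpectrum.isCoprime_of_ne h).pow) x

instance (m : MaximalSpectrum R) : Finite (LocalComponent m) :=
  Finite.of_surjective _ Ideal.Quotient.mk_surjective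

theorem maximalIdeal_localComponent (m : MaximalSpectrum R) :
    maximalIdeal (LocalComponent m) =
      m.asIdeal.map (Ideal.Quotient.mk (m.asIdeal ^ stabilityIndex m.asIdeal)) := by
  set I := m.asIdeal ^ stabilityIndex m.asIdeal with hI
  have hsurj : Function.Surjective (Ideal.Quotient.mk I) := Ideal.Quotient.mk_surjective
  have hc : ((maximalIdeal (LocalComponent m)).comap (Ideal.Quotient.mk I)).IsMaximal :=
    Ideal.comap_isMaximal_of_surjective _ hsurj
  have h1 : I ≤ (maximalIdeal (LocalComponent m)).comap (Ideal.Quotient.mk I) := by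
    rw [← Ideal.map_le_iff_le_comap, Ideal.map_quotient_self]
    exact bot_le
  have h2 := m.isMaximal.eq_of_le hc.ne_top (hc.isPrime.le_of_pow_le h1)
  exact (Ideal.map_comap_of_surjective _ hsurj _).symm.trans
    (congrArg (Ideal.map (Ideal.Quotient.mk I)) h2.symm)

/-- Pulled back to `R`, powers of the maximal ideal acquire the summand `𝔪 ^ t`, which changes
nothing up to exponent `t`; beyond it both chains are constant. -/
theorem stabilityIndex_localComponent (m : MaximalSpectrum R) :
    stabilityIndex (maximalIdeal (LocalComponent m)) = stabilityIndex m.asIdeal := by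
  have hsurj := Ideal.Quotient.mk_surjective (I := m.asIdeal ^ stabilityIndex m.asIdeal)
  refine congrArg sInf (Set.ext fun e => and_congr_right fun _ => ?_)
  rw [maximalIdeal_localComponent, ← Ideal.map_pow, ← Ideal.map_pow,
    Ideal.map_eq_iff_sup_ker_eq_of_surjective _ hsurj, Ideal.mk_ker]
  rcases le_or_gt (stabilityIndex m.asIdeal) e with h | h
  · rw [pow_eq_pow_stabilityIndex _ h, pow_eq_pow_stabilityIndex _ (h.trans e.le_succ)]
    simp
  · rw [sup_eq_left.2 (Ideal.pow_le_pow_right h.le),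
      sup_eq_left.2 (Ideal.pow_le_pow_right (Nat.succ_le_of_lt h))]

theorem exists_generator_maximalIdeal {S : Type*} [CommRing S] [Finite S] [IsLocalRing S]
    (hS : (maximalIdeal S).IsPrincipal) :
    ∃ γ, maximalIdeal S = Ideal.span {γ} ∧ γ ^ stabilityIndex (maximalIdeal S) = 0 ∧
      ∀ j < stabilityIndex (maximalIdeal S), γ ^ j ≠ 0 := by
  obtain ⟨γ, hγ⟩ := hS
  rw [Ideal.submodule_span_eq] at hγ
  have hpow : ∀ j, maximalIdeal S ^ j = Ideal.span {γ ^ j} := fun j => by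
    rw [hγ, Ideal.span_singleton_pow]
  have hzero : ∀ j, maximalIdeal S ^ j = ⊥ ↔ γ ^ j = 0 := fun j => by
    rw [hpow, Ideal.span_singleton_eq_bot]
  refine ⟨γ, hγ, ?_, fun j hj h0 => ?_⟩
  · obtain ⟨N, hN⟩ := IsArtinianRing.isNilpotent_jacobson_bot (R := S)
    rw [jacobson_eq_maximalIdeal _ bot_ne_top] at hN
    rw [← hzero, ← pow_eq_pow_stabilityIndex _ (Nat.le_add_right _ N), pow_add, hN, mul_zero]
    rfl
  · rcases Nat.eq_zero_or_pos j with rfl | hpos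
    · simp at h0
    · refine absurd hj (not_lt.2 (Nat.sInf_le ⟨hpos, ?_⟩))
      rw [(hzero j).2 h0, (hzero (j + 1)).2 (by rw [pow_succ, h0, zero_mul])]

theorem exists_generator_localComponent [IsPrincipalIdealRing R] (m : MaximalSpectrum R)
    (heven : Even (stabilityIndex m.asIdeal)) :
    ∃ (γ : LocalComponent m) (e : ℕ), stabilityIndex (maximalIdeal (LocalComponent m)) = 2 * e ∧
      maximalIdeal (LocalComponent m) = Ideal.span {γ} ∧ γ ^ (2 * e) = 0 ∧
      ∀ j < 2 * e, γ ^ j ≠ 0 := by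
  have hprin : (maximalIdeal (LocalComponent m)).IsPrincipal := by
    rw [maximalIdeal_localComponent]
    exact (IsPrincipalIdealRing.principal m.asIdeal).map_ringHom _
  obtain ⟨γ, hP, hγ, hne⟩ := exists_generator_maximalIdeal hprin
  obtain ⟨e, he⟩ := heven
  rw [← two_mul, ← stabilityIndex_localComponent] at he
  rw [he] at hγ hne
  exact ⟨γ, e, he, hP, hγ, hne⟩

end Decomposition

/-! ### Codes over `R` and their components -/

section Codes

variable {R : Type*} [CommRing R] {n : ℕ}

theorem isCyclic_iff_forall_shift [NeZero n] (C : Submodule R (Fin n → R)) :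
    IsCyclic C ↔ ∀ c ∈ C, ∀ k, (fun i => c (i - k)) ∈ C := by
  have h1 : ∀ i : Fin n, (finRotate n).symm i = i - 1 := fun i => finRotate_symm_apply i
  simp only [IsCyclic, h1]
  refine ⟨fun h c hc k => ?_, fun h c hc => h c hc 1⟩
  have hk : k = k.val • 1 := Fin.ext (by rw [val_nsmul_one, Nat.mod_eq_of_lt k.isLt])
  rw [hk]
  generalize k.val = j
  induction j with
  | zero => simpa using hc
  | succ j ih => simpa [succ_nsmul', sub_sub] using h _ ih

theorem mem_trivialCode_iff {S : Type*} [CommRing S] [IsLocalRing S] {γ : S} {e : ℕ}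
    (hP : IsLocalRing.maximalIdeal S = Ideal.span {γ})
    (he : stabilityIndex (IsLocalRing.maximalIdeal S) = 2 * e) (u : Fin n → S) :
    u ∈ trivialCode S n ↔ ∀ i, γ ^ e ∣ u i := by
  rw [trivialCode, he, Nat.mul_div_cancel_left _ two_pos]
  simp [hP, Ideal.span_singleton_pow, Ideal.mem_span_singleton]

/-- Self-orthogonality puts the component inside the trivial code. Conversely, a trivial codeword
extended by zero to the other components is orthogonal to `C`, as `γ ^ e * γ ^ e = 0`, so it lies in
`dual C = C`. -/
theorem component_eq_trivialCode [Finite R] [IsPrincipalIdealRing R] [NeZero n]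
    (m : MaximalSpectrum R) (heven : Even (stabilityIndex m.asIdeal))
    {C : Submodule R (Fin n → R)} (hcyc : IsCyclic C) (hdual : IsSelfDual C) {s : ℕ} (hs : s ≠ 0)
    (h : (residueCard m : ZMod n) ^ s = -1) :
    component C m = trivialCode (LocalComponent m) n := by
  classical
  obtain ⟨γ, e, he, hP, hγ, hne⟩ := exists_generator_localComponent m heven
  have horth : ∀ u ∈ C, ∀ v ∈ C, ∑ i, u i * v i = 0 := fun u hu v hv => by
    rw [hdual] at hu
    exact hu v hv
  have hle : ∀ u ∈ C, ∀ i,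
      γ ^ e ∣ Ideal.Quotient.mk (m.asIdeal ^ stabilityIndex m.asIdeal) (u i) :=
    fun u hu => pow_dvd_of_mem_of_selfOrthogonal hP hne hs (pow_nsmul_eq_neg h) _ fun k => by
      have := horth u hu _ ((isCyclic_iff_forall_shift C).1 hcyc u hu k)
      simpa using congrArg (Ideal.Quotient.mk (m.asIdeal ^ stabilityIndex m.asIdeal)) this
  ext v
  rw [mem_trivialCode_iff hP he]
  constructor
  · rintro ⟨u, hu, rfl⟩
    exact hle u hu
  · intro hv
    choose u hu using fun i => exists_forall_mk_eq (Pi.single m (v i))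
    refine ⟨u, ?_, funext fun i => (hu i m).trans (Pi.single_eq_same _ _)⟩
    rw [SetLike.mem_coe, hdual]
    intro w hw
    refine eq_zero_of_forall_mk_eq_zero fun m' => ?_
    rw [map_sum]
    refine Finset.sum_eq_zero fun i _ => ?_
    rw [map_mul, hu]
    rcases eq_or_ne m' m with rfl | hm
    · obtain ⟨a, ha⟩ := hv i
      obtain ⟨b, hb⟩ := hle w hw i
      rw [Pi.single_eq_same, ha, hb, mul_mul_mul_comm, ← pow_add, ← two_mul, hγ, zero_mul]
    · rw [Pi.single_eq_of_ne hm, zero_mul]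

theorem exists_selfDual_ne_trivialCode [Finite R] [IsPrincipalIdealRing R] [NeZero n]
    (m : MaximalSpectrum R) (heven : Even (stabilityIndex m.asIdeal))
    (hcop : n.Coprime (residueCard m)) (h : ∀ s, (residueCard m : ZMod n) ^ s ≠ -1) :
    ∃ D : Submodule (LocalComponent m) (Fin n → LocalComponent m),
      IsCyclic D ∧ IsSelfDual D ∧ D ≠ trivialCode (LocalComponent m) n := by
  obtain ⟨γ, e, he, hP, hγ, hne⟩ := exists_generator_localComponent m heven
  have hpos := (stabilityIndex_spec (IsLocalRing.maximalIdeal (LocalComponent m))).1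
  rw [he] at hpos
  obtain ⟨θ, h1, h2, i, hi⟩ := exists_isIdempotentElem_lift hP hγ (G := Fin n)
    (by rwa [Nat.card_fin]) 1 fun s => pow_nsmul_one_ne_neg_one (h s)
  obtain ⟨D, hD1, hD2, hD3⟩ := exists_selfDual_of_isIdempotentElem hP hγ hne h1 h2
  refine ⟨D, (isCyclic_iff_forall_shift D).2 hD1, Submodule.ext hD2, fun hD => hi ?_⟩
  rw [hD, mem_trivialCode_iff hP he] at hD3
  exact (dvd_pow_self γ (by omega)).trans (hD3 i)

/-- The code over `R` with prescribed components over the local components of `R`. -/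
noncomputable def ofComponents [Finite R]
    (D : ∀ m : MaximalSpectrum R, Submodule (LocalComponent m) (Fin n → LocalComponent m)) :
    Submodule R (Fin n → R) :=
  ⨅ m, (D m).comap (reduction (m.asIdeal ^ stabilityIndex m.asIdeal) n)

section OfComponents

variable [Finite R]
  {D : ∀ m : MaximalSpectrum R, Submodule (LocalComponent m) (Fin n → LocalComponent m)}

theorem mem_ofComponents {u : Fin n → R} : u ∈ ofComponents D ↔
    ∀ m, reduction (m.asIdeal ^ stabilityIndex m.asIdeal) n u ∈ D m := by
  simp [ofComponents]

/-- Extension by zero lets components and orthogonality be tested at one maximal ideal at a time. -/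
theorem exists_mem_ofComponents (m : MaximalSpectrum R) {v : Fin n → LocalComponent m}
    (hv : v ∈ D m) : ∃ u ∈ ofComponents D,
      reduction (m.asIdeal ^ stabilityIndex m.asIdeal) n u = v ∧
      ∀ m' ≠ m, reduction (m'.asIdeal ^ stabilityIndex m'.asIdeal) n u = 0 := by
  classical
  choose u hu using fun i => exists_forall_mk_eq (Pi.single m (v i))
  have h1 : reduction (m.asIdeal ^ stabilityIndex m.asIdeal) n u = v :=
    funext fun i => (hu i m).trans (Pi.single_eq_same _ _)
  have h2 : ∀ m' ≠ m, reduction (m'.asIdeal ^ stabilityIndex m'.asIdeal) n u = 0 :=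
    fun m' hm => funext fun i => (hu i m').trans (Pi.single_eq_of_ne hm _)
  refine ⟨u, mem_ofComponents.2 fun m' => ?_, h1, h2⟩
  rcases eq_or_ne m' m with rfl | hm
  · rwa [h1]
  · rw [h2 m' hm]
    exact zero_mem _

theorem component_ofComponents (m : MaximalSpectrum R) : component (ofComponents D) m = D m := by
  refine le_antisymm ?_ fun v hv => ?_
  · rintro _ ⟨u, hu, rfl⟩
    exact mem_ofComponents.1 hu m
  · obtain ⟨u, hu, h, -⟩ := exists_mem_ofComponents m hv
    exact ⟨u, hu, h⟩

theorem isCyclic_ofComponents (h : ∀ m, IsCyclic (D m)) : IsCyclic (ofComponents D) :=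
  fun _ hc => mem_ofComponents.2 fun m => h m _ (mem_ofComponents.1 hc m)

theorem isSelfDual_ofComponents (h : ∀ m, IsSelfDual (D m)) : IsSelfDual (ofComponents D) := by
  have hmk : ∀ (m : MaximalSpectrum R) (u v : Fin n → R),
      Ideal.Quotient.mk (m.asIdeal ^ stabilityIndex m.asIdeal) (∑ i, u i * v i) =
        ∑ i, reduction (m.asIdeal ^ stabilityIndex m.asIdeal) n u i *
          reduction (m.asIdeal ^ stabilityIndex m.asIdeal) n v i := fun m u v => by
    rw [map_sum]
    exact Finset.sum_congr rfl fun i _ => map_mul _ _ _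
  ext u
  constructor
  · intro hu v hv
    refine eq_zero_of_forall_mk_eq_zero fun m => ?_
    rw [hmk]
    have := mem_ofComponents.1 hu m
    rw [h m] at this
    exact this _ (mem_ofComponents.1 hv m)
  · intro hu
    refine mem_ofComponents.2 fun m => ?_
    rw [h m]
    intro v hv
    obtain ⟨w, hw, rfl, -⟩ := exists_mem_ofComponents m hv
    rw [← hmk, hu w hw, map_zero]

end OfComponents

end Codes

end CyclicCodes

theorem mainTheorem2 {R : Type*} [CommRing R] [Finite R] [IsPrincipalIdealRing R]
    (heven : ∀ m : MaximalSpectrum R, Even (CyclicCodes.stabilityIndex m.asIdeal))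
    (n : ℕ) (hn : IsPrimePow n) (hodd : Odd n)
    (hcop : ∀ m : MaximalSpectrum R, Nat.Coprime n (CyclicCodes.residueCard m)) :
    (∃ C : Submodule R (Fin n → R),
        CyclicCodes.IsCyclic C ∧ CyclicCodes.IsSelfDual C ∧ CyclicCodes.IsNontrivial C) ↔
      ∀ m : MaximalSpectrum R, Odd (orderOf (CyclicCodes.residueCard m : ZMod n)) := by
  have : NeZero n := ⟨hn.ne_zero⟩
  have hn2 : 2 < n := by
    obtain ⟨k, rfl⟩ := hodd
    have := hn.one_lt
    omega
  constructor
  · rintro ⟨C, hcyc, hdual, hnt⟩ m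
    by_contra hm
    rw [Nat.not_odd_iff_even] at hm
    obtain ⟨s, hs, h⟩ :=
      CyclicCodes.exists_pow_eq_neg_one_of_even_orderOf hn hodd (hcop m) hm
    exact hnt m (CyclicCodes.component_eq_trivialCode m (heven m) hcyc hdual hs h)
  · intro h
    choose D h1 h2 h3 using fun m => CyclicCodes.exists_selfDual_ne_trivialCode m (heven m)
      (hcop m) (CyclicCodes.pow_ne_neg_one_of_odd_orderOf hn2 (h m))
    refine ⟨CyclicCodes.ofComponents D, CyclicCodes.isCyclic_ofComponents h1,
      CyclicCodes.isSelfDual_ofComponents h2, fun m => ?_⟩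
    rw [CyclicCodes.component_ofComponents]
    exact h3 m
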